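/- Let $T_1=\{3214,3241,4213,4231\}$ and, for $n\ge 1$, let $S_n(T_1)$ be the set of permutations $\sigma=\sigma(1)\cdots\sigma(n)$ of $\{1,\dots,n\}$ that avoid all four patterns in $T_1$, and let $B_n^{(1)}$ be the set of those $\sigma\in S_n(T_1)$ with $\sigma(n)=n$. Let $\mathrm{asc}(\sigma)$ be the number of ascents of $\sigma$, that is, of positions $1\le i<n$ with $\sigma(i)<\sigma(i+1)$, and consider the formal power series $$F(x,y)=\sum_{n\ge 1}\sum_{\sigma\in S_n(T_1)}x^n y^{\mathrm{asc}(\sigma)},\qquad E(x,y)=\sum_{n\ge 1}\sum_{\sigma\in B_n^{(1)}}x^n y^{\mathrm{asc}(\sigma)}.$$ Then $$F(x,y)=\frac{E(x,y)\,\bigl(1-yE(x,y)\bigr)}{1-E(x,y)-yE(x,y)},$$ and $$E(x,y)=\frac{\sqrt{1-4xy+4x^2y(y-1)}-1}{2y\,\bigl(x(y-1)-1\bigr)},$$ where the square root is the formal power series with constant term $1$. -/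

import Mathlib

/-- The word `w` contains the pattern `p` when some subsequence of `w`, of the same length as `p`,
has its letters in the same relative order as those of `p`. -/
def ContainsPattern {n k : ℕ} (w : Fin n → ℕ) (p : Fin k → ℕ) : Prop :=
  ∃ f : Fin k → Fin n, StrictMono f ∧ ∀ i j : Fin k, p i < p j ↔ w (f i) < w (f j)

/-- One-line notation `σ(1) σ(2) ⋯ σ(n)` of a permutation, as a word with letters `1, …, n`
(`Fin n` is `{0, …, n - 1}`, so values are shifted by one). -/
def oneLine {n : ℕ} (σ : Equiv.Perm (Fin n)) : Fin n → ℕ := fun i => (σ i : ℕ) + 1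

/-- The set of patterns `{3214, 3241, 4213, 4231}`. -/
def T₁ : Set (Fin 4 → ℕ) := {![3, 2, 1, 4], ![3, 2, 4, 1], ![4, 2, 1, 3], ![4, 2, 3, 1]}

/-- `σ` avoids every pattern of the set `T`. -/
def Avoids {n k : ℕ} (σ : Equiv.Perm (Fin n)) (T : Set (Fin k → ℕ)) : Prop :=
  ∀ p ∈ T, ¬ ContainsPattern (oneLine σ) p

/-- `S_n(T₁)`: the permutations of length `n` that avoid `T₁`. -/
def avT₁ (n : ℕ) : Set (Equiv.Perm (Fin n)) := {σ | Avoids σ T₁}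

/-- The permutations in `S_n(T₁)` whose last symbol is the maximum symbol `n`. -/
def avT₁EndingInMax (n : ℕ) : Set (Equiv.Perm (Fin n)) :=
  {σ | σ ∈ avT₁ n ∧ ∃ i : Fin n, (i : ℕ) + 1 = n ∧ oneLine σ i = n}

/-- The number of ascents of `σ`: positions `i` with `σ(i) < σ(i + 1)`. -/
noncomputable def asc {n : ℕ} (σ : Equiv.Perm (Fin n)) : ℕ :=
  {i : Fin n | ∃ j : Fin n, (j : ℕ) = (i : ℕ) + 1 ∧ σ i < σ j}.ncard

/-- The ring `ℚ⟦x, y⟧` of formal power series; `x` is variable `0` and `y` is variable `1`. -/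
abbrev QXY : Type := MvPowerSeries (Fin 2) ℚ

/-- The variable `x`. -/
noncomputable def varX : QXY := MvPowerSeries.X 0

/-- The variable `y`. -/
noncomputable def varY : QXY := MvPowerSeries.X 1

/-- The ascent generating function `∑_{n ≥ 1} ∑_{σ ∈ C n} x ^ n * y ^ asc σ` of a class `C` of
permutations: the coefficient of `x ^ n * y ^ k` is the number of `σ ∈ C n` with `k` ascents if
`n ≥ 1`, and `0` if `n = 0`. -/
noncomputable def ascGenFun (C : (n : ℕ) → Set (Equiv.Perm (Fin n))) : QXY :=
  fun m => if 1 ≤ m 0 then (({σ | σ ∈ C (m 0) ∧ asc σ = m 1}.ncard : ℕ) : ℚ) else 0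

/-- `F(x, y)`: the ascent generating function over the permutations that avoid `T₁`. -/
noncomputable def genF : QXY := ascGenFun avT₁

/-- `E(x, y)`: the ascent generating function over the permutations that avoid `T₁` and end with
their maximum symbol. -/
noncomputable def genE : QXY := ascGenFun avT₁EndingInMax

/-- The field of fractions of `ℚ⟦x, y⟧`, in which quotients of power series are formed. -/
abbrev QXYFrac : Type := FractionRing QXY

/-- A power series as an element of the field of fractions. -/
noncomputable def toFrac (f : QXY) : QXYFrac := algebraMap QXY QXYFrac f

/-!
A letter with a larger letter before it, and both a smaller and a larger letter after it, is what the
four patterns of `T₁` have in common, so `σ` avoids `T₁` exactly when each of its letters is a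
left-to-right maximum or *suffix-extreme*, that is, the largest or the smallest of the letters from
its position on (`mem_avT₁_iff`).

Permutations are built from right to left. Prepending a letter `v` to `τ` changes no status of being
suffix-extreme, and it keeps the class exactly when `v` is at most the *height* of `τ`, the least
letter that is not suffix-extreme, or the length if there is none (`prependLetter_mem_avT₁_iff`). The
new height is determined by the length, the old height and `v` (`height_prependLetter`), and whether
an ascent is gained is determined by `v` and the first letter of `τ` (`asc_prependLetter`). So
`S_n(T₁)` is a generating tree whose states are triples (length, height, first letter); ending in the
maximum means starting from the one-letter permutation and never prepending a new maximum.

Let the weight of a state be the generating function of all ways to continue prepending letters. Any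
family of power series that satisfies the one-step recurrence for the weights yields, by telescoping,
the ascent generating function (`ascGenFun_eq_of_weight`). The recurrence has an explicit solution
made of geometric sums in the series `z` with `z = 1 + x y (1 + x (1 - y)) z²`: for a state that is
not full (height less than length) with a positive first letter the weight is `z ^ (h + 1)`, and the
others follow by the method of undetermined coefficients (`weight_eq`, `weightEndingInMax_eq`). At
length one this gives `E = x z` and `F = x z (1 - x y z) / (1 - x (1 + y) z)`, and
`1 - 2 x y (1 + x (1 - y)) z` is the square root.
-/

/-! ### Prepending a letter to a permutation -/

/-- The permutation of length `n + 1` whose first letter is `v` and whose remaining letters are in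
the same relative order as those of `τ`. -/
def prependLetter {n : ℕ} (v : Fin (n + 1)) (τ : Equiv.Perm (Fin n)) : Equiv.Perm (Fin (n + 1)) :=
  (finSuccEquiv n).trans ((Equiv.optionCongr τ).trans (finSuccEquiv' v).symm)

@[simp] lemma prependLetter_zero {n : ℕ} (v : Fin (n + 1)) (τ : Equiv.Perm (Fin n)) :
    prependLetter v τ 0 = v := by
  simp [prependLetter]

@[simp] lemma prependLetter_succ {n : ℕ} (v : Fin (n + 1)) (τ : Equiv.Perm (Fin n)) (i : Fin n) :
    prependLetter v τ i.succ = v.succAbove (τ i) := by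
  simp [prependLetter]

lemma prependLetter_bijective (n : ℕ) :
    Function.Bijective
      (fun p : Fin (n + 1) × Equiv.Perm (Fin n) => prependLetter p.1 p.2) := by
  rw [Fintype.bijective_iff_injective_and_card]
  constructor
  · rintro ⟨v, τ⟩ ⟨v', τ'⟩ h
    have h0 : v = v' := by simpa using congrArg (fun σ : Equiv.Perm (Fin (n + 1)) => σ 0) h
    subst h0
    have h1 : τ = τ' := by
      ext i : 1
      have := congrArg (fun σ : Equiv.Perm (Fin (n + 1)) => σ i.succ) h
      simpa using this
    rw [h1]
  · simp [Fintype.card_perm, Nat.factorial_succ]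

lemma exists_eq_prependLetter {n : ℕ} (σ : Equiv.Perm (Fin (n + 1))) :
    ∃ v τ, σ = prependLetter v τ := by
  obtain ⟨⟨v, τ⟩, h⟩ := (prependLetter_bijective n).2 σ
  exact ⟨v, τ, h.symm⟩

lemma lt_succAbove_iff_le_val {n : ℕ} (v : Fin (n + 1)) (i : Fin n) :
    v < v.succAbove i ↔ (v : ℕ) ≤ i := by
  rw [Fin.lt_succAbove_iff_le_castSucc, Fin.le_def, Fin.val_castSucc]

lemma succAbove_lt_iff_val_lt {n : ℕ} (v : Fin (n + 1)) (i : Fin n) :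
    v.succAbove i < v ↔ (i : ℕ) < v := by
  rw [Fin.succAbove_lt_iff_castSucc_lt, Fin.lt_def, Fin.val_castSucc]

lemma asc_eq_sum {n : ℕ} (σ : Equiv.Perm (Fin (n + 1))) :
    asc σ = ∑ i : Fin n, if σ i.castSucc < σ i.succ then 1 else 0 := by
  -- in the definition of `asc` the last position never counts
  have h : {i : Fin (n + 1) | ∃ j : Fin (n + 1), (j : ℕ) = (i : ℕ) + 1 ∧ σ i < σ j} =
      Fin.castSucc '' ((Finset.univ.filter fun i : Fin n => σ i.castSucc < σ i.succ : Finset _) :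
        Set (Fin n)) := by
    ext i
    simp only [Set.mem_ofPred_eq, Finset.coe_filter, Finset.mem_univ, true_and, Set.mem_image]
    constructor
    · rintro ⟨j, hj, hlt⟩
      have hi : (i : ℕ) < n := by omega
      refine ⟨⟨i, hi⟩, ?_, rfl⟩
      have e : (⟨i, hi⟩ : Fin n).succ = j := by ext; simp [hj]
      rw [e]
      exact hlt
    · rintro ⟨k, hk, rfl⟩
      exact ⟨k.succ, by simp, hk⟩
  rw [asc, h, Set.ncard_image_of_injective _ (Fin.castSucc_injective n), Set.ncard_coe_finset,
    Finset.card_filter]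

lemma asc_of_length_one (σ : Equiv.Perm (Fin 1)) : asc σ = 0 := by
  rw [asc_eq_sum]; simp

lemma asc_prependLetter {n : ℕ} (v : Fin (n + 2)) (τ : Equiv.Perm (Fin (n + 1))) :
    asc (prependLetter v τ) = asc τ + if (v : ℕ) ≤ τ 0 then 1 else 0 := by
  rw [asc_eq_sum, asc_eq_sum, Fin.sum_univ_succ, add_comm]
  congr 1
  · refine Finset.sum_congr rfl fun i _ => ?_
    rw [Fin.castSucc_succ, prependLetter_succ, prependLetter_succ]
    simp only [Fin.succAbove_lt_succAbove_iff]
  · rw [Fin.castSucc_zero, prependLetter_zero, prependLetter_succ]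
    simp only [lt_succAbove_iff_le_val]

/-! ### Suffix-extreme letters and the height of a permutation -/

/-- The letter at position `j` is larger than all later letters, or smaller than all of them. -/
def IsSuffixExtreme {n : ℕ} (σ : Equiv.Perm (Fin n)) (j : Fin n) : Prop :=
  (∀ k, j < k → σ k < σ j) ∨ ∀ k, j < k → σ j < σ k

/-- Avoiding `T₁` means that every letter is a left-to-right maximum or suffix-extreme: the patterns
of `T₁` are those in which the letter `2` has a larger letter before it and letters of both kinds
after it. -/
lemma mem_avT₁_iff {n : ℕ} (σ : Equiv.Perm (Fin n)) :
    σ ∈ avT₁ n ↔ ∀ j, (∀ i, i < j → σ i < σ j) ∨ IsSuffixExtreme σ j := by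
  have hne : ∀ {a b : Fin n}, a < b → σ a ≠ σ b := fun h e => h.ne (σ.injective e)
  constructor
  · intro h j
    by_contra! hj
    obtain ⟨⟨i, hij, hi⟩, hE⟩ := hj
    simp only [IsSuffixExtreme, not_or, not_forall, not_lt] at hE
    obtain ⟨⟨l, hjl, hl⟩, k, hjk, hk⟩ := hE
    have hi' := lt_of_le_of_ne hi (hne hij).symm
    have hl' := lt_of_le_of_ne hl (hne hjl)
    have hk' := lt_of_le_of_ne hk (hne hjk).symm
    have hkl : k ≠ l := by rintro rfl; exact absurd hl' hk'.asymm
    have hil : σ i ≠ σ l := hne (hij.trans hjl)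
    have key : ∀ (p : Fin 4 → ℕ) (a b : Fin n), p ∈ T₁ → j < a → a < b →
        (∀ s t : Fin 4, p s < p t ↔ σ (![i, j, a, b] s) < σ (![i, j, a, b] t)) → False := by
      intro p a b hp ha hb hst
      refine h p hp ⟨![i, j, a, b], ?_, fun s t => ?_⟩
      · intro s t hlt
        fin_cases s <;> fin_cases t <;> simp at hlt ⊢ <;> order
      · rw [hst]; simp [oneLine]
    rcases lt_or_gt_of_ne hkl with h1 | h1 <;> rcases lt_or_gt_of_ne hil with h2 | h2
    · refine key ![3, 2, 1, 4] k l (by simp [T₁]) hjk h1 fun s t => ?_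
      fin_cases s <;> fin_cases t <;> simp <;> order
    · refine key ![4, 2, 1, 3] k l (by simp [T₁]) hjk h1 fun s t => ?_
      fin_cases s <;> fin_cases t <;> simp <;> order
    · refine key ![3, 2, 4, 1] l k (by simp [T₁]) hjl h1 fun s t => ?_
      fin_cases s <;> fin_cases t <;> simp <;> order
    · refine key ![4, 2, 3, 1] l k (by simp [T₁]) hjl h1 fun s t => ?_
      fin_cases s <;> fin_cases t <;> simp <;> order
  · rintro h p hp ⟨f, hf, hpat⟩
    have h01 : f 0 < f 1 := hf (by decide)
    have h12 : f 1 < f 2 := hf (by decide)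
    have h13 : f 1 < f 3 := hf (by decide)
    have hlt : ∀ s t, p s < p t → σ (f s) < σ (f t) := fun s t hst => by
      simpa [oneLine] using (hpat s t).1 hst
    have hE : σ (f 1) < σ (f 0) ∧ (σ (f 1) < σ (f 2) ∧ σ (f 3) < σ (f 1) ∨
        σ (f 2) < σ (f 1) ∧ σ (f 1) < σ (f 3)) := by
      simp only [T₁, Set.mem_insert_iff, Set.mem_singleton_iff] at hp
      rcases hp with rfl | rfl | rfl | rfl
      · exact ⟨hlt 1 0 (by decide), Or.inr ⟨hlt 2 1 (by decide), hlt 1 3 (by decide)⟩⟩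
      · exact ⟨hlt 1 0 (by decide), Or.inl ⟨hlt 1 2 (by decide), hlt 3 1 (by decide)⟩⟩
      · exact ⟨hlt 1 0 (by decide), Or.inr ⟨hlt 2 1 (by decide), hlt 1 3 (by decide)⟩⟩
      · exact ⟨hlt 1 0 (by decide), Or.inl ⟨hlt 1 2 (by decide), hlt 3 1 (by decide)⟩⟩
    rcases h (f 1) with h1 | h1 | h1
    · exact (h1 _ h01).asymm hE.1
    · rcases hE.2 with h2 | h2
      · exact (h1 _ h12).asymm h2.1
      · exact (h1 _ h13).asymm h2.2
    · rcases hE.2 with h2 | h2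
      · exact (h1 _ h13).asymm h2.2
      · exact (h1 _ h12).asymm h2.1

/-- The least letter (counted from `0`) that is not suffix-extreme, or the length if there is none.
A letter can be prepended within `S_n(T₁)` exactly when it is at most the height. -/
noncomputable def height {n : ℕ} (σ : Equiv.Perm (Fin n)) : ℕ :=
  sInf (insert n {m | ∃ j, ¬ IsSuffixExtreme σ j ∧ (σ j : ℕ) = m})

lemma le_height_iff {n : ℕ} (σ : Equiv.Perm (Fin n)) (m : ℕ) :
    m ≤ height σ ↔ m ≤ n ∧ ∀ j, ¬ IsSuffixExtreme σ j → m ≤ σ j := by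
  rw [height, le_csInf_iff (OrderBot.bddBelow _) ⟨n, Set.mem_insert _ _⟩]
  simp

lemma height_le {n : ℕ} (σ : Equiv.Perm (Fin n)) : height σ ≤ n :=
  ((le_height_iff σ _).1 le_rfl).1

lemma isSuffixExtreme_prependLetter_succ {n : ℕ} (v : Fin (n + 1)) (τ : Equiv.Perm (Fin n))
    (j : Fin n) : IsSuffixExtreme (prependLetter v τ) j.succ ↔ IsSuffixExtreme τ j := by
  simp [IsSuffixExtreme, Fin.forall_fin_succ]

lemma isSuffixExtreme_prependLetter_zero {n : ℕ} (v : Fin (n + 1)) (τ : Equiv.Perm (Fin n)) :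
    IsSuffixExtreme (prependLetter v τ) 0 ↔ (v : ℕ) = 0 ∨ (v : ℕ) = n := by
  simp only [IsSuffixExtreme, Fin.forall_fin_succ, prependLetter_zero, prependLetter_succ,
    lt_self_iff_false, false_imp_iff, true_and, Fin.succ_pos, true_imp_iff, lt_succAbove_iff_le_val,
    succAbove_lt_iff_val_lt]
  rw [or_comm]
  refine or_congr ⟨fun h => ?_, fun h k => by omega⟩ ⟨fun h => ?_, fun h k => by omega⟩
  · by_contra h0
    have := h (τ.symm ⟨0, by omega⟩)
    simp only [Equiv.apply_symm_apply] at this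
    omega
  · by_contra h0
    have := h (τ.symm ⟨n - 1, by omega⟩)
    simp only [Equiv.apply_symm_apply] at this
    omega

lemma prependLetter_mem_avT₁_iff {n : ℕ} (v : Fin (n + 1)) (τ : Equiv.Perm (Fin n)) :
    prependLetter v τ ∈ avT₁ (n + 1) ↔ τ ∈ avT₁ n ∧ (v : ℕ) ≤ height τ := by
  simp only [mem_avT₁_iff, le_height_iff, Fin.forall_fin_succ (n := n),
    isSuffixExtreme_prependLetter_succ, prependLetter_zero, prependLetter_succ,
    lt_succAbove_iff_le_val, Fin.succAbove_lt_succAbove_iff, Fin.succ_pos, true_imp_iff,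
    Fin.succ_lt_succ_iff, Fin.not_lt_zero, false_imp_iff, lt_self_iff_false, implies_true, and_true,
    true_and, true_or]
  constructor
  · intro h
    refine ⟨fun j => (h j).imp_left And.right, v.is_le, fun j hj => ?_⟩
    exact ((h j).resolve_right hj).1
  · rintro ⟨h1, -, h2⟩ j
    by_cases hj : IsSuffixExtreme τ j
    · exact Or.inr hj
    · exact Or.inl ⟨h2 j hj, (h1 j).resolve_right hj⟩

/-- The height of a permutation obtained by prepending the letter `v` to one of length `N` and
height `h`. -/
def nextHeight (N h v : ℕ) : ℕ :=
  if v = 0 then h + 1 else if v = N then N + 1 else v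

lemma height_prependLetter {n : ℕ} (v : Fin (n + 1)) (τ : Equiv.Perm (Fin n))
    (hv : (v : ℕ) ≤ height τ) : height (prependLetter v τ) = nextHeight n (height τ) v := by
  have hle := height_le τ
  refine eq_of_forall_le_iff fun m => ?_
  simp only [le_height_iff (prependLetter v τ), Fin.forall_fin_succ (n := n),
    isSuffixExtreme_prependLetter_succ, isSuffixExtreme_prependLetter_zero, prependLetter_zero,
    prependLetter_succ]
  -- prepending `v` raises by one every letter that is not suffix-extreme
  have hbad : ∀ j, ¬ IsSuffixExtreme τ j → (v.succAbove (τ j) : ℕ) = τ j + 1 := fun j hj => by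
    rw [Fin.succAbove_of_le_castSucc, Fin.val_succ]
    exact ((le_height_iff τ _).1 hv).2 j hj
  have hbad' : (∀ j, ¬ IsSuffixExtreme τ j → m ≤ (v.succAbove (τ j) : ℕ)) ↔
      ∀ j, ¬ IsSuffixExtreme τ j → m ≤ (τ j : ℕ) + 1 :=
    forall₂_congr fun j hj => by rw [hbad j hj]
  rw [hbad']
  unfold nextHeight
  split_ifs with h0 h1
  · have := le_height_iff τ (m - 1)
    simp only [Nat.sub_le_iff_le_add] at this
    rw [this]
    simp [h0]
  · -- a height at least the length `n` leaves no letter that is not suffix-extreme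
    have hh : ∀ j, IsSuffixExtreme τ j := fun j => by
      by_contra hj
      have := ((le_height_iff τ _).1 hv).2 j hj
      have := (τ j).is_lt
      omega
    simp [h1, hh]
  · constructor
    · rintro ⟨-, h, -⟩
      exact h (by omega)
    · intro h
      refine ⟨by omega, fun _ => h, fun j hj => ?_⟩
      have := ((le_height_iff τ _).1 hv).2 j hj
      omega

/-- Every permutation of length `n + 1` that avoids `T₁` starts with its least letter, or with its
greatest letter followed by suffix-extreme letters only, or with a letter equal to its height. -/
lemma height_cases {n : ℕ} {σ : Equiv.Perm (Fin (n + 1))} (hσ : σ ∈ avT₁ (n + 1)) :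
    (σ 0 : ℕ) = 0 ∨ ((σ 0 : ℕ) = n ∧ height σ = n + 1) ∨
      ((σ 0 : ℕ) = height σ ∧ 0 < height σ ∧ height σ < n + 1) := by
  obtain ⟨v, τ, rfl⟩ := exists_eq_prependLetter σ
  have hv := ((prependLetter_mem_avT₁_iff v τ).1 hσ).2
  rw [height_prependLetter v τ hv, prependLetter_zero]
  have := v.is_le
  unfold nextHeight
  split_ifs <;> omega

lemma mem_avT₁EndingInMax_iff {n : ℕ} (σ : Equiv.Perm (Fin (n + 1))) :
    σ ∈ avT₁EndingInMax (n + 1) ↔ σ ∈ avT₁ (n + 1) ∧ σ (Fin.last n) = Fin.last n := by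
  refine and_congr_right fun _ => ⟨?_, fun h => ⟨Fin.last n, by simp, by simp [oneLine, h]⟩⟩
  rintro ⟨i, hi, h⟩
  have e : i = Fin.last n := Fin.ext (by simpa using hi)
  subst e
  exact Fin.ext (by simpa [oneLine] using h)

lemma prependLetter_mem_avT₁EndingInMax_iff {n : ℕ} (v : Fin (n + 2))
    (τ : Equiv.Perm (Fin (n + 1))) :
    prependLetter v τ ∈ avT₁EndingInMax (n + 2) ↔
      τ ∈ avT₁EndingInMax (n + 1) ∧ (v : ℕ) ≤ height τ ∧ (v : ℕ) < n + 1 := by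
  rw [mem_avT₁EndingInMax_iff, mem_avT₁EndingInMax_iff, prependLetter_mem_avT₁_iff,
    ← Fin.succ_last, prependLetter_succ]
  have hv := v.is_lt
  have : v.succAbove (τ (Fin.last n)) = (Fin.last n).succ ↔
      τ (Fin.last n) = Fin.last n ∧ (v : ℕ) < n + 1 := by
    have h1 := (τ (Fin.last n)).is_lt
    simp only [Fin.ext_iff, Fin.succAbove, Fin.lt_def, Fin.val_castSucc, Fin.val_succ, Fin.val_last]
    split_ifs <;> simp <;> omega
  rw [this]
  tauto

/-! ### Summing a statistic over all ways of prepending a letter -/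

lemma coeff_monomial_sum {k : ℕ} {ι : Type*} (s : Finset ι) (a : ι → ℕ) (m : Fin 2 →₀ ℕ) :
    MvPowerSeries.coeff m (varX ^ k * ∑ i ∈ s, varY ^ a i) =
      if m 0 = k then ((s.filter fun i => a i = m 1).card : ℚ) else 0 := by
  have h : ∀ i, MvPowerSeries.coeff m (varX ^ k * varY ^ a i) =
      if m 0 = k ∧ a i = m 1 then (1 : ℚ) else 0 := fun i => by
    rw [varX, varY, MvPowerSeries.X_pow_eq, MvPowerSeries.X_pow_eq,
      MvPowerSeries.monomial_mul_monomial, MvPowerSeries.coeff_monomial, one_mul]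
    refine if_congr ?_ rfl rfl
    simp [Finsupp.ext_iff, Fin.forall_fin_two, eq_comm]
  rw [Finset.mul_sum, map_sum]
  simp only [h]
  split_ifs with hk <;> simp [hk]

/-- Suppose that prepending `v` to `τ ∈ C` (of length `N`) stays in the class `C` exactly when `v`
is below a bound depending on `N` and the height of `τ`. If a weight, depending on the length, the
height and the first letter, satisfies the recurrence of the generating function of all ways to
continue prepending letters, then the ascent generating function of `C` is read off from the weight
at length one. -/
theorem ascGenFun_eq_of_weight (C : (n : ℕ) → Set (Equiv.Perm (Fin n))) (b : ℕ → ℕ → ℕ)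
    (W : ℕ → ℕ → ℕ → QXY)
    (hb : ∀ N h, b N h ≤ h + 1)
    (hC : ∀ n (v : Fin (n + 2)) (τ : Equiv.Perm (Fin (n + 1))),
      prependLetter v τ ∈ C (n + 2) ↔ τ ∈ C (n + 1) ∧ (v : ℕ) < b (n + 1) (height τ))
    (hW : ∀ n (τ : Equiv.Perm (Fin (n + 1))), τ ∈ C (n + 1) →
      W (n + 1) (height τ) (τ 0) = 1 + varX * ∑ v ∈ Finset.range (b (n + 1) (height τ)),
        varY ^ (if v ≤ τ 0 then 1 else 0) * W (n + 2) (nextHeight (n + 1) (height τ) v) v)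
    (h1 : ∀ σ, σ ∈ C 1) :
    ascGenFun C = varX * W 1 1 0 := by
  classical
  -- the weighted sum over the class at length `n + 1`
  let Φ : ℕ → QXY := fun n =>
    ∑ σ ∈ (Finset.univ.filter (· ∈ C (n + 1)) : Finset (Equiv.Perm (Fin (n + 1)))),
      varY ^ asc σ * W (n + 1) (height σ) (σ 0)
  let s : ℕ → QXY := fun n =>
    ∑ σ ∈ (Finset.univ.filter (· ∈ C (n + 1)) : Finset (Equiv.Perm (Fin (n + 1)))), varY ^ asc σ
  have hstep : ∀ n, Φ n = s n + varX * Φ (n + 1) := fun n => by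
    have e : Φ (n + 1) = ∑ τ ∈ (Finset.univ.filter (· ∈ C (n + 1)) :
        Finset (Equiv.Perm (Fin (n + 1)))), varY ^ asc τ *
          ∑ v ∈ Finset.range (b (n + 1) (height τ)), varY ^ (if v ≤ τ 0 then 1 else 0) *
            W (n + 2) (nextHeight (n + 1) (height τ) v) v := by
      simp only [Φ, Finset.sum_filter]
      rw [← (prependLetter_bijective (n + 1)).sum_comp, Fintype.sum_prod_type, Finset.sum_comm]
      refine Finset.sum_congr rfl fun τ _ => ?_
      have hle : b (n + 1) (height τ) ≤ n + 2 :=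
        (hb _ _).trans (Nat.succ_le_succ (height_le τ))
      by_cases hτ : τ ∈ C (n + 1)
      · have hterm : ∀ v : Fin (n + 2),
            (if prependLetter v τ ∈ C (n + 1 + 1) then varY ^ asc (prependLetter v τ) *
              W (n + 1 + 1) (height (prependLetter v τ)) (prependLetter v τ 0) else 0) =
            if (v : ℕ) < b (n + 1) (height τ) then varY ^ asc τ *
              (varY ^ (if (v : ℕ) ≤ τ 0 then 1 else 0) *
                W (n + 2) (nextHeight (n + 1) (height τ) v) v) else 0 := fun v => by
          refine ite_congr (by simp [hC, hτ]) (fun hv => ?_) fun _ => rfl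
          rw [asc_prependLetter, prependLetter_zero, pow_add, mul_assoc,
            height_prependLetter v τ (by have := hb (n + 1) (height τ); omega)]
        simp only [hterm]
        rw [if_pos hτ, Finset.mul_sum, Fin.sum_univ_eq_sum_range (fun v =>
          if v < b (n + 1) (height τ) then varY ^ asc τ * (varY ^ (if v ≤ τ 0 then 1 else 0) *
            W (n + 2) (nextHeight (n + 1) (height τ) v) v) else 0) (n + 2), ← Finset.sum_filter]
        refine Finset.sum_congr (Finset.ext fun v => ?_) fun _ _ => rfl
        simp only [Finset.mem_filter, Finset.mem_range]
        omega
      · simp [hC, hτ]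
    rw [e, Finset.mul_sum, ← Finset.sum_add_distrib]
    refine Finset.sum_congr rfl fun τ hτ => ?_
    rw [hW n τ (Finset.mem_filter.1 hτ).2]
    ring
  -- telescoping, up to a remainder divisible by `x ^ (K + 1)`
  have htel : ∀ K, varX * Φ 0 =
      ∑ k ∈ Finset.range K, varX ^ (k + 1) * s k + varX ^ (K + 1) * Φ K := fun K => by
    induction K with
    | zero => simp
    | succ K ih => rw [ih, hstep K, Finset.sum_range_succ]; ring
  have hΦ : Φ 0 = W 1 1 0 := by
    have hht : ∀ σ : Equiv.Perm (Fin 1), height σ = 1 := fun σ =>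
      le_antisymm (height_le σ) ((le_height_iff σ 1).2 ⟨le_rfl, fun j hj => absurd (Or.inl
        fun k hk => absurd hk (by simp [Subsingleton.elim j k])) hj⟩)
    simp [Φ, h1, hht, asc_of_length_one]
  rw [← hΦ]
  ext m
  have hrest : MvPowerSeries.coeff m (varX ^ (m 0 + 1) * Φ (m 0)) = 0 :=
    MvPowerSeries.X_pow_dvd_iff.1 (Dvd.intro _ rfl) m (Nat.lt_succ_self _)
  rw [htel (m 0), map_add, hrest, add_zero, map_sum]
  simp only [s, coeff_monomial_sum]
  change (if 1 ≤ m 0 then _ else _) = _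
  obtain hm | ⟨N, hm⟩ : m 0 = 0 ∨ ∃ N, m 0 = N + 1 := by
    cases h : m 0 <;> simp
  · simp [hm]
  · rw [Finset.sum_eq_single N]
    · rw [if_pos (by omega), if_pos hm, hm, Finset.filter_filter, ← Set.ncard_coe_finset]
      simp
    · intro k _ hk
      rw [if_neg (by omega)]
    · simp [hm]

/-! ### Weights solving the recurrence -/

section Weights

variable {R : Type*} [CommRing R] (x y z d u : R)

/-- Weight of a state of height `h` that is not full and whose first letter is positive. -/
def weightBad (h : ℕ) : R := z ^ (h + 1)

/-- Weight of a state of height `h` that is not full and whose first letter is the least one. -/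
def weightZero (h : ℕ) : R :=
  z ^ (h + 1) + x * (1 - y) * z ^ 2 * ∑ i ∈ Finset.range h, z ^ i

/-- Weight of the increasing permutation of length `n + 1`, within the class of those permutations
that end in their maximum; `u` stands for the inverse of `1 + x (1 - y) z`. -/
def weightIncreasing (n : ℕ) : R :=
  z + x * (1 + x * (1 - y)) * z ^ 3 * u * ∑ i ∈ Finset.range n, z ^ i

/-- Weight of a permutation of length `n + 1` all of whose letters are suffix-extreme and whose
first letter is the least one; `d` stands for the inverse of `1 - x (1 + y) z`. -/
def weightFullZero (n : ℕ) : R :=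
  (z * (1 - x * y * z) + x * z ^ 2 * (1 - x * (1 - y) * z) * ∑ i ∈ Finset.range n, z ^ i) * d

/-- Weight of a permutation of length `n + 1` all of whose letters are suffix-extreme and whose
first letter is the greatest one. -/
def weightFullMax (n : ℕ) : R :=
  weightFullZero x y z d n - x * (1 - y) * z ^ 2 * ∑ i ∈ Finset.range n, z ^ i

variable {x y z d u}

lemma sum_weightBad (h : ℕ) :
    ∑ v ∈ Finset.range h, weightBad z (v + 1) = z ^ 2 * ∑ i ∈ Finset.range h, z ^ i := by
  rw [Finset.mul_sum]
  exact Finset.sum_congr rfl fun i _ => by rw [weightBad]; ring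

lemma pow_eq_one_add_mul_geom_sum (z : R) (h : ℕ) :
    z ^ h = 1 + (z - 1) * ∑ i ∈ Finset.range h, z ^ i := by
  rw [mul_geom_sum]; ring

lemma weightZero_eq (hz : z = 1 + x * y * (1 + x * (1 - y)) * z ^ 2) (h : ℕ) :
    weightZero x y z h =
      1 + x * (y * weightZero x y z (h + 1) + ∑ v ∈ Finset.range h, weightBad z (v + 1)) := by
  rw [sum_weightBad]
  simp only [weightZero, Finset.sum_range_succ, pow_succ]
  have hg := pow_eq_one_add_mul_geom_sum z h
  generalize ∑ i ∈ Finset.range h, z ^ i = G at *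
  generalize z ^ h = Z at *
  linear_combination (Z + G) * hz + hg

lemma weightBad_eq (hz : z = 1 + x * y * (1 + x * (1 - y)) * z ^ 2) (h : ℕ) :
    weightBad z h =
      1 + x * (y * weightZero x y z (h + 1) + y * ∑ v ∈ Finset.range h, weightBad z (v + 1)) := by
  rw [sum_weightBad]
  simp only [weightBad, weightZero, Finset.sum_range_succ, pow_succ]
  have hg := pow_eq_one_add_mul_geom_sum z h
  generalize ∑ i ∈ Finset.range h, z ^ i = G at *
  generalize z ^ h = Z at *
  linear_combination (Z + G) * hz + hg

lemma weightIncreasing_eq (hz : z = 1 + x * y * (1 + x * (1 - y)) * z ^ 2)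
    (hu : (1 + x * (1 - y) * z) * u = 1) (n : ℕ) :
    weightIncreasing x y z u n = 1 + x * (y * weightIncreasing x y z u (n + 1) +
      ∑ v ∈ Finset.range n, weightBad z (v + 1)) := by
  rw [sum_weightBad]
  simp only [weightIncreasing, Finset.sum_range_succ]
  have hg := pow_eq_one_add_mul_geom_sum z n
  generalize ∑ i ∈ Finset.range n, z ^ i = G at *
  generalize z ^ n = Z at *
  linear_combination u * (1 + x * z + x * z ^ 2 * G) * hz
    - u * x ^ 2 * y * (1 + x * (1 - y)) * z ^ 3 * hg - (z - 1 - x * y * z - x * z ^ 2 * G) * hu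

lemma weightFullZero_eq (hz : z = 1 + x * y * (1 + x * (1 - y)) * z ^ 2)
    (hd : d * (1 - x * (1 + y) * z) = 1) (n : ℕ) :
    weightFullZero x y z d n = 1 + x * (y * weightFullZero x y z d (n + 1) +
      ∑ v ∈ Finset.range n, weightBad z (v + 1) + weightFullMax x y z d (n + 1)) := by
  rw [sum_weightBad]
  simp only [weightFullMax, weightFullZero, Finset.sum_range_succ]
  have hg := pow_eq_one_add_mul_geom_sum z n
  generalize ∑ i ∈ Finset.range n, z ^ i = G at *
  generalize z ^ n = Z at *
  linear_combination d * hz + (-d * (x * (1 + y)) * (x * z ^ 2 * (1 - x * (1 - y) * z)) +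
    x ^ 2 * (1 - y) * z ^ 2) * hg -
    (-1 + x ^ 2 * (1 - y) * z ^ 2 - x * z ^ 2 * (1 - x * (1 - y) * z) * G) * hd

lemma weightFullMax_eq (hz : z = 1 + x * y * (1 + x * (1 - y)) * z ^ 2)
    (hd : d * (1 - x * (1 + y) * z) = 1) (n : ℕ) :
    weightFullMax x y z d n = 1 + x * (y * weightFullZero x y z d (n + 1) +
      y * ∑ v ∈ Finset.range n, weightBad z (v + 1) + weightFullMax x y z d (n + 1)) := by
  have h := weightFullZero_eq hz hd n
  have e : weightFullMax x y z d n = weightFullZero x y z d n -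
    x * (1 - y) * z ^ 2 * ∑ i ∈ Finset.range n, z ^ i := rfl
  rw [sum_weightBad] at h ⊢
  rw [e]
  linear_combination h

variable (x y z d u)

/-- The weight for `S_n(T₁)` of a permutation of length `N` and height `h` with first letter `a`. -/
def weight (N h a : ℕ) : R :=
  if h = N then if a = 0 then weightFullZero x y z d (N - 1) else weightFullMax x y z d (N - 1)
  else if a = 0 then weightZero x y z h else weightBad z h

/-- The weight for the permutations in `S_n(T₁)` that end in their maximum; here the height equals
the length only for the increasing permutation. -/
def weightEndingInMax (N h a : ℕ) : R :=
  if h = N then weightIncreasing x y z u (N - 1)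
  else if a = 0 then weightZero x y z h else weightBad z h

variable {x y z d u}

lemma weight_eq (hz : z = 1 + x * y * (1 + x * (1 - y)) * z ^ 2)
    (hd : d * (1 - x * (1 + y) * z) = 1) {n h a : ℕ} (hh : h ≤ n + 1)
    (ha : a = 0 ∨ (a = n ∧ h = n + 1) ∨ (a = h ∧ 0 < h ∧ h < n + 1)) :
    weight x y z d (n + 1) h a = 1 + x * ∑ v ∈ Finset.range (h + 1),
      y ^ (if v ≤ a then 1 else 0) * weight x y z d (n + 2) (nextHeight (n + 1) h v) v := by
  rw [Finset.sum_range_succ']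
  have h0 : y ^ (if 0 ≤ a then 1 else 0) * weight x y z d (n + 2) (nextHeight (n + 1) h 0) 0 =
      y * if h = n + 1 then weightFullZero x y z d (n + 1) else weightZero x y z (h + 1) := by
    simp [nextHeight, weight]
  have hmid : ∀ k, k ≤ n → ∑ v ∈ Finset.range k, y ^ (if v + 1 ≤ a then 1 else 0) *
      weight x y z d (n + 2) (nextHeight (n + 1) h (v + 1)) (v + 1) =
      ∑ v ∈ Finset.range k, y ^ (if v + 1 ≤ a then 1 else 0) * weightBad z (v + 1) := by
    refine fun k hk => Finset.sum_congr rfl fun v hv => ?_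
    have hv := Finset.mem_range.1 hv
    have e : nextHeight (n + 1) h (v + 1) = v + 1 := by
      rw [nextHeight, if_neg (by omega), if_neg (by omega)]
    rw [e, weight, if_neg (by omega : v + 1 ≠ n + 2), if_neg v.succ_ne_zero]
  have hall : ∀ k, k ≤ a → ∑ v ∈ Finset.range k, y ^ (if v + 1 ≤ a then 1 else 0) *
      weightBad z (v + 1) = y * ∑ v ∈ Finset.range k, weightBad z (v + 1) := by
    intro k hk
    rw [Finset.mul_sum]
    refine Finset.sum_congr rfl fun v hv => ?_
    rw [if_pos (by have := Finset.mem_range.1 hv; omega), pow_one]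
  have hnone : ∀ k, a = 0 → ∑ v ∈ Finset.range k, y ^ (if v + 1 ≤ a then 1 else 0) *
      weightBad z (v + 1) = ∑ v ∈ Finset.range k, weightBad z (v + 1) := by
    intro k hk
    simp [hk]
  rw [h0, add_comm (Finset.sum _ _)]
  by_cases hf : h = n + 1
  · subst hf
    have hmax : y ^ (if n + 1 ≤ a then 1 else 0) *
        weight x y z d (n + 2) (nextHeight (n + 1) (n + 1) (n + 1)) (n + 1) =
        weightFullMax x y z d (n + 1) := by
      rw [if_neg (by omega)]
      simp [nextHeight, weight]
    rw [Finset.sum_range_succ, hmax, hmid n le_rfl, if_pos rfl, ← add_assoc, weight, if_pos rfl]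
    by_cases ha0 : a = 0
    · rw [if_pos ha0, hnone _ ha0]
      exact weightFullZero_eq hz hd n
    · rw [if_neg ha0, hall _ (by omega)]
      exact weightFullMax_eq hz hd n
  · rw [if_neg hf, hmid h (by omega), weight, if_neg hf]
    by_cases ha0 : a = 0
    · rw [if_pos ha0, hnone _ ha0]
      exact weightZero_eq hz h
    · rw [if_neg ha0, hall _ (by omega)]
      exact weightBad_eq hz h

lemma weightEndingInMax_eq (hz : z = 1 + x * y * (1 + x * (1 - y)) * z ^ 2)
    (hu : (1 + x * (1 - y) * z) * u = 1) {n h a : ℕ} (hh : h ≤ n + 1)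
    (ha : a = 0 ∨ (a = h ∧ 0 < h ∧ h < n + 1)) :
    weightEndingInMax x y z u (n + 1) h a = 1 + x * ∑ v ∈ Finset.range (min (h + 1) (n + 1)),
      y ^ (if v ≤ a then 1 else 0) *
        weightEndingInMax x y z u (n + 2) (nextHeight (n + 1) h v) v := by
  rw [Nat.add_min_add_right, Finset.sum_range_succ']
  have h0 : y ^ (if 0 ≤ a then 1 else 0) *
      weightEndingInMax x y z u (n + 2) (nextHeight (n + 1) h 0) 0 =
      y * if h = n + 1 then weightIncreasing x y z u (n + 1) else weightZero x y z (h + 1) := by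
    simp [nextHeight, weightEndingInMax]
  have hmid : ∑ v ∈ Finset.range (min h n), y ^ (if v + 1 ≤ a then 1 else 0) *
      weightEndingInMax x y z u (n + 2) (nextHeight (n + 1) h (v + 1)) (v + 1) =
      ∑ v ∈ Finset.range (min h n), y ^ (if v + 1 ≤ a then 1 else 0) * weightBad z (v + 1) := by
    refine Finset.sum_congr rfl fun v hv => ?_
    have hv := Finset.mem_range.1 hv
    have e : nextHeight (n + 1) h (v + 1) = v + 1 := by
      rw [nextHeight, if_neg (by omega), if_neg (by omega)]
    rw [e, weightEndingInMax, if_neg (by omega : v + 1 ≠ n + 2), if_neg v.succ_ne_zero]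
  rw [h0, hmid, add_comm (Finset.sum _ _), weightEndingInMax]
  rcases ha with rfl | ⟨rfl, hpos, hlt⟩
  · simp only [Nat.le_zero, Nat.add_one_ne_zero, if_false, pow_zero, one_mul, if_true]
    by_cases hf : h = n + 1
    · rw [if_pos hf, if_pos hf, min_eq_right (by omega)]
      exact weightIncreasing_eq hz hu n
    · rw [if_neg hf, if_neg hf, min_eq_left (by omega)]
      exact weightZero_eq hz h
  · rw [if_neg hlt.ne, if_neg hlt.ne, if_neg hpos.ne', min_eq_left (by omega), weightBad_eq hz,
      Finset.mul_sum]
    congr 3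
    refine Finset.sum_congr rfl fun v hv => ?_
    rw [if_pos (by have := Finset.mem_range.1 hv; omega), pow_one]

end Weights

/-! ### The generating functions -/

/-- The Catalan series, evaluated at a power series without constant term. -/
lemma exists_eq_one_add_mul_sq (c : QXY) (hc : MvPowerSeries.constantCoeff c = 0) :
    ∃ z : QXY, z = 1 + c * z ^ 2 := by
  have hs : PowerSeries.HasSubst c := PowerSeries.HasSubst.of_constantCoeff_zero hc
  refine ⟨PowerSeries.substAlgHom (R := ℚ) hs
    (PowerSeries.map (Nat.castRingHom ℚ) PowerSeries.catalanSeries), ?_⟩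
  conv_lhs => rw [← PowerSeries.catalanSeries_sq_mul_X_add_one]
  simp only [map_add, map_mul, map_pow, map_one, PowerSeries.map_X, PowerSeries.substAlgHom_X]
  ring

theorem theorem15 :
    -- `F = E (1 - y E) / (1 - E - y E)`; the denominator is an invertible power series
    IsUnit (1 - genE - varY * genE) ∧
    toFrac genF = toFrac (genE * (1 - varY * genE)) / toFrac (1 - genE - varY * genE) ∧
    -- `E = (√(1 - 4xy + 4x²y(y - 1)) - 1) / (2y(x(y - 1) - 1))`, where the root is the
    -- power series with constant term `1`
    toFrac (2 * varY * (varX * (varY - 1) - 1)) ≠ 0 ∧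
    ∃ S : QXY,
      S ^ 2 = 1 - 4 * varX * varY + 4 * varX ^ 2 * varY * (varY - 1) ∧
      MvPowerSeries.constantCoeff S = 1 ∧
      toFrac genE = toFrac (S - 1) / toFrac (2 * varY * (varX * (varY - 1) - 1)) := by
  have hX : MvPowerSeries.constantCoeff varX = 0 := MvPowerSeries.constantCoeff_X 0
  obtain ⟨z, hz⟩ := exists_eq_one_add_mul_sq (varX * varY * (1 + varX * (1 - varY)))
    (by simp [hX])
  have hunit1 : IsUnit (1 - varX * (1 + varY) * z) := by
    rw [MvPowerSeries.isUnit_iff_constantCoeff]; simp [hX]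
  have hunit2 : IsUnit (1 + varX * (1 - varY) * z) := by
    rw [MvPowerSeries.isUnit_iff_constantCoeff]; simp [hX]
  obtain ⟨d, hd⟩ := hunit1.exists_left_inv
  obtain ⟨u, hu⟩ := hunit2.exists_right_inv
  have hF : genF = varX * (z * (1 - varX * varY * z) * d) := by
    rw [genF, ascGenFun_eq_of_weight avT₁ (fun _ h => h + 1) (weight varX varY z d)
      (fun _ _ => le_rfl)
      (fun n v τ => by rw [prependLetter_mem_avT₁_iff, Nat.lt_succ_iff])
      (fun n τ hτ => weight_eq hz hd (height_le τ) (height_cases hτ))]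
    · simp [weight, weightFullZero]
    · exact fun σ => (mem_avT₁_iff σ).2 fun j => Or.inl fun i hi =>
        absurd hi (by simp [Subsingleton.elim i j])
  have hE : genE = varX * z := by
    rw [genE, ascGenFun_eq_of_weight avT₁EndingInMax (fun N h => min (h + 1) N)
      (weightEndingInMax varX varY z u) (fun _ _ => min_le_left _ _)
      (fun n v τ => by
        rw [prependLetter_mem_avT₁EndingInMax_iff, lt_min_iff, Nat.lt_succ_iff (n := height τ)])
      (fun n τ hτ => weightEndingInMax_eq hz hu (height_le τ) ?_)]
    · simp [weightEndingInMax, weightIncreasing]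
    · exact fun σ => (mem_avT₁EndingInMax_iff σ).2 ⟨(mem_avT₁_iff σ).2 fun j => Or.inl fun i hi =>
        absurd hi (by simp [Subsingleton.elim i j]),
        Subsingleton.elim (α := Fin 1) _ _⟩
    · rw [mem_avT₁EndingInMax_iff] at hτ
      rcases height_cases hτ.1 with h | ⟨h, -⟩ | h
      · exact Or.inl h
      · -- the first letter is the greatest, hence also the last letter, so the length is one
        have h1 : τ 0 = τ (Fin.last n) := by rw [hτ.2]; exact Fin.ext h
        have h2 : n = 0 := by simpa [Fin.ext_iff, eq_comm] using τ.injective h1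
        exact Or.inl (by omega)
      · exact Or.inr h
  have hinj : ∀ {f : QXY}, f ≠ 0 → toFrac f ≠ 0 := fun hf =>
    (map_ne_zero_iff _ (IsFractionRing.injective QXY QXYFrac)).2 hf
  have hden : 1 - genE - varY * genE = 1 - varX * (1 + varY) * z := by rw [hE]; ring
  have hne : toFrac (2 * varY * (varX * (varY - 1) - 1)) ≠ 0 := by
    refine hinj (mul_ne_zero (mul_ne_zero (fun h => ?_) fun h => ?_) fun h => ?_)
    · have h2 : (MvPowerSeries.constantCoeff (2 : QXY) : ℚ) = 2 := map_ofNat _ 2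
      simp [h] at h2
    · simpa [varY] using congrArg (MvPowerSeries.coeff (Finsupp.single 1 1)) h
    · simpa [hX] using congrArg MvPowerSeries.constantCoeff h
  refine ⟨hden ▸ hunit1, ?_, hne, 1 - 2 * (varX * varY * (1 + varX * (1 - varY))) * z, ?_, ?_, ?_⟩
  · rw [hden, eq_div_iff (hinj hunit1.ne_zero), toFrac, toFrac, toFrac, ← map_mul, hF, hE]
    congr 1
    linear_combination varX * z * (1 - varX * varY * z) * hd
  · -- `(1 - 2 c z)² = 1 - 4 c (z - c z²)`, with `c = x y (1 + x (1 - y))`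
    linear_combination (-4 * (varX * varY * (1 + varX * (1 - varY)))) * hz
  · simp [hX]
  · rw [eq_div_iff hne, toFrac, toFrac, toFrac, ← map_mul, hE]
    congr 1
    ring
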